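/- For a finite simple graph $H$ of order $n\ge 1$, let $\lambda_1(H)\ge\lambda_2(H)\ge\dots\ge\lambda_n(H)$ denote the eigenvalues of its adjacency matrix, counted with multiplicity, and let $\overline{H}$ denote the complement of $H$. Let $G$ be a bipartite graph of order $n\ge 1$ (not assumed to be connected; a part of the bipartition may be empty). Then $$\lambda_1(\overline{G})=-1-\lambda_n(G)$$ if and only if $G$ is a balanced complete bipartite graph, that is, $G\cong K_{r,r}$ for some integer $r\ge 1$. -/

import Mathlib

/-- The `i`-th eigenvalue of the adjacency matrix of the finite graph `G`. The eigenvalues are listed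
with multiplicity in non-increasing order, the index starting at `0`. -/
noncomputable def SimpleGraph.adjEigenvalue {V : Type*} [Fintype V] [DecidableEq V]
    (G : SimpleGraph V) [DecidableRel G.Adj] (i : Fin (Fintype.card V)) : ℝ :=
  (SimpleGraph.isHermitian_adjMatrix ℝ G).eigenvalues₀ i

/-- The largest eigenvalue `λ₁(G)` of a finite non-empty graph. -/
noncomputable def SimpleGraph.largestEigenvalue {V : Type*} [Fintype V] [Nonempty V] [DecidableEq V]
    (G : SimpleGraph V) [DecidableRel G.Adj] : ℝ :=
  G.adjEigenvalue ⟨0, Fintype.card_pos⟩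

/-- The least eigenvalue `λₙ(G)` of a finite non-empty graph of order `n`. -/
noncomputable def SimpleGraph.leastEigenvalue {V : Type*} [Fintype V] [Nonempty V] [DecidableEq V]
    (G : SimpleGraph V) [DecidableRel G.Adj] : ℝ :=
  G.adjEigenvalue ⟨Fintype.card V - 1, Nat.sub_lt Fintype.card_pos one_pos⟩

open Matrix Finset

namespace SimpleGraph

variable {V : Type*} [Fintype V]

/-! A colour class of size `k` is a clique of the complement, so `k - 1 ≤ λ₁(Gᶜ)`; under the assumed
equality every inhabited class has size at most `-λₙ(G)`. Conversely, where an eigenvector for `λₙ`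
has maximal modulus, `|λₙ|` is at most the degree, hence at most the size of the opposite class. All
these bounds are therefore equalities, which forces a complete and balanced bipartition
(`exists_balanced_of_card_le_neg_leastEigenvalue`). For `K_{r,r}`, both the graph and its complement
are regular and the two eigenvalues are explicit. -/

theorem nonempty_iso_completeBipartiteGraph_iff {G : SimpleGraph V} {r : ℕ} :
    Nonempty (G ≃g completeBipartiteGraph (Fin r) (Fin r)) ↔
      ∃ c : V → Bool, (∀ x y, G.Adj x y ↔ c x ≠ c y) ∧ ∀ b, #{x | c x = b} = r := by
  constructor
  · rintro ⟨e⟩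
    refine ⟨fun x ↦ (e x).isLeft, fun x y ↦ ?_, fun b ↦ ?_⟩
    · rw [← e.map_adj_iff]
      rcases hx : e x with _ | _ <;> rcases hy : e y with _ | _ <;> simp [hx, hy]
    · have : #{x | (e x).isLeft = b} = #{z : Fin r ⊕ Fin r | z.isLeft = b} :=
        card_equiv e.toEquiv (by simp)
      rw [this, card_filter, Fintype.sum_sum_type]
      cases b <;> simp
  · rintro ⟨c, hadj, hcard⟩
    have equiv (b : Bool) : {x // c x = b} ≃ Fin r :=
      Fintype.equivFinOfCardEq (by rw [Fintype.card_subtype, hcard])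
    have equivNot : {x // ¬ c x = true} ≃ Fin r :=
      (Equiv.subtypeEquivRight fun x ↦ by simp).trans (equiv false)
    refine ⟨⟨(Equiv.sumCompl (c · = true)).symm.trans ((equiv true).sumCongr equivNot), ?_⟩⟩
    intro x y
    rw [hadj]
    by_cases hx : c x = true <;> by_cases hy : c y = true <;>
      simp [Equiv.sumCompl_symm_apply_of_pos, Equiv.sumCompl_symm_apply_of_neg, hx, hy]

variable (G : SimpleGraph V) [DecidableRel G.Adj]

variable {G} in
theorem neighborFinset_eq_of_adj_iff_ne {c : V → Bool} (hadj : ∀ x y, G.Adj x y ↔ c x ≠ c y) (x : V) :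
    G.neighborFinset x = ({y | c y = !c x} : Finset V) := by
  ext y
  rw [mem_neighborFinset, hadj, mem_filter_univ]
  cases c x <;> cases c y <;> simp

variable {G} in
theorem degree_eq_of_adj_iff_ne {c : V → Bool} {r : ℕ}
    (hadj : ∀ x y, G.Adj x y ↔ c x ≠ c y) (hcard : ∀ b, #{x | c x = b} = r) (x : V) : G.degree x = r := by
  rw [← card_neighborFinset_eq_degree, neighborFinset_eq_of_adj_iff_ne hadj, hcard]

variable {G} in
/-- The eigenvalue equation at a coordinate of maximal modulus. -/
theorem abs_le_degree_of_abs_maximal {μ : ℝ} {v : V → ℝ} (h : G.adjMatrix ℝ *ᵥ v = μ • v)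
    {x : V} (hx : v x ≠ 0) (hmax : ∀ y, |v y| ≤ |v x|) : |μ| ≤ G.degree x := by
  have hsum : ∑ y ∈ G.neighborFinset x, v y = μ * v x := by
    simpa [adjMatrix_mulVec_apply] using congrFun h x
  refine le_of_mul_le_mul_right ?_ (abs_pos.2 hx)
  calc |μ| * |v x| = |∑ y ∈ G.neighborFinset x, v y| := by rw [hsum, abs_mul]
    _ ≤ ∑ y ∈ G.neighborFinset x, |v y| := abs_sum_le_sum_abs _ _
    _ ≤ ∑ _y ∈ G.neighborFinset x, |v x| := sum_le_sum fun y _ ↦ hmax y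
    _ = G.degree x * |v x| := by simp

variable {G} in
-- Equality case of the preceding bound: no term of the triangle inequality can be strictly smaller,
-- so maximality of the modulus spreads to the neighbours.
theorem abs_eq_of_adj_of_degree_le_abs {μ : ℝ} {v : V → ℝ} (h : G.adjMatrix ℝ *ᵥ v = μ • v)
    {x y : V} (hmax : ∀ y, |v y| ≤ |v x|) (hμ : (G.degree x : ℝ) ≤ |μ|) (hxy : G.Adj x y) :
    |v y| = |v x| := by
  have hsum : ∑ y ∈ G.neighborFinset x, v y = μ * v x := by
    simpa [adjMatrix_mulVec_apply] using congrFun h x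
  refine (sum_eq_sum_iff_of_le fun y _ ↦ hmax y).1 (le_antisymm (sum_le_sum fun y _ ↦ hmax y) ?_)
    y ((G.mem_neighborFinset x y).2 hxy)
  calc ∑ _y ∈ G.neighborFinset x, |v x| = G.degree x * |v x| := by simp
    _ ≤ |μ| * |v x| := by gcongr
    _ = |∑ y ∈ G.neighborFinset x, v y| := by rw [hsum, abs_mul]
    _ ≤ ∑ y ∈ G.neighborFinset x, |v y| := abs_sum_le_sum_abs _ _

theorem exists_ne_zero_abs_maximal {v : V → ℝ} (hv : v ≠ 0) :
    ∃ x, v x ≠ 0 ∧ ∀ y, |v y| ≤ |v x| := by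
  obtain ⟨z, hz⟩ := Function.ne_iff.1 hv
  obtain ⟨x, -, hx⟩ := exists_max_image univ (fun y ↦ |v y|) ⟨z, mem_univ z⟩
  exact ⟨x, abs_pos.1 ((abs_pos.2 hz).trans_le (hx z (mem_univ z))), fun y ↦ hx y (mem_univ y)⟩

variable [DecidableEq V]

theorem adjEigenvalue_antitone : Antitone G.adjEigenvalue :=
  (isHermitian_adjMatrix ℝ G).eigenvalues₀_antitone

theorem spectrum_adjMatrix_eq_range_adjEigenvalue :
    spectrum ℝ (G.adjMatrix ℝ) = Set.range G.adjEigenvalue := by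
  rw [(isHermitian_adjMatrix ℝ G).spectrum_real_eq_range_eigenvalues]
  exact (Equiv.surjective _).range_comp _

theorem exists_eigenvector_adjEigenvalue (i : Fin (Fintype.card V)) :
    ∃ v : V → ℝ, v ≠ 0 ∧ G.adjMatrix ℝ *ᵥ v = G.adjEigenvalue i • v := by
  have h : G.adjEigenvalue i ∈ spectrum ℝ (G.adjMatrix ℝ) := by
    rw [spectrum_adjMatrix_eq_range_adjEigenvalue]
    exact ⟨i, rfl⟩
  rw [← spectrum_toLin'] at h
  obtain ⟨v, hv⟩ := (Module.End.HasEigenvalue.of_mem_spectrum h).exists_hasEigenvector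
  exact ⟨v, hv.2, by simpa using hv.apply_eq_smul⟩

variable {G} in
theorem exists_adjEigenvalue_eq {μ : ℝ} {v : V → ℝ} (hv : v ≠ 0)
    (h : G.adjMatrix ℝ *ᵥ v = μ • v) : ∃ i, G.adjEigenvalue i = μ := by
  have : μ ∈ spectrum ℝ (G.adjMatrix ℝ) := by
    rw [← spectrum_toLin', ← Module.End.hasEigenvalue_iff_mem_spectrum]
    refine Module.End.hasEigenvalue_of_hasEigenvector (x := v) ⟨?_, hv⟩
    rw [Module.End.mem_eigenspace_iff]
    simpa using h
  rwa [spectrum_adjMatrix_eq_range_adjEigenvalue] at this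

theorem adjEigenvalue_le_largestEigenvalue [Nonempty V] (i : Fin (Fintype.card V)) :
    G.adjEigenvalue i ≤ G.largestEigenvalue :=
  G.adjEigenvalue_antitone (Fin.mk_le_of_le_val (Nat.zero_le _))

theorem leastEigenvalue_le_adjEigenvalue [Nonempty V] (i : Fin (Fintype.card V)) :
    G.leastEigenvalue ≤ G.adjEigenvalue i :=
  G.adjEigenvalue_antitone (Fin.le_def.2 (Nat.le_sub_one_of_lt i.2))

variable {G} in
theorem abs_adjEigenvalue_le_of_degree_le {d : ℕ} (hd : ∀ x, G.degree x ≤ d)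
    (i : Fin (Fintype.card V)) : |G.adjEigenvalue i| ≤ d := by
  obtain ⟨v, hv, h⟩ := G.exists_eigenvector_adjEigenvalue i
  obtain ⟨x, hx, hmax⟩ := exists_ne_zero_abs_maximal hv
  exact (abs_le_degree_of_abs_maximal h hx hmax).trans (by exact_mod_cast hd x)

/-- Rayleigh bound: `λ₁ - A` is positive semidefinite, since its spectrum consists of the numbers
`λ₁ - λᵢ ≥ 0`. -/
theorem dotProduct_adjMatrix_mulVec_le [Nonempty V] (v : V → ℝ) :
    v ⬝ᵥ (G.adjMatrix ℝ *ᵥ v) ≤ G.largestEigenvalue * (v ⬝ᵥ v) := by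
  have hpsd : (algebraMap ℝ (Matrix V V ℝ) G.largestEigenvalue - G.adjMatrix ℝ).PosSemidef := by
    rw [posSemidef_iff_isHermitian_and_spectrum_nonneg]
    constructor
    · refine IsHermitian.sub ?_ (isHermitian_adjMatrix ℝ G)
      rw [algebraMap_eq_diagonal]
      exact isHermitian_diagonal _
    · rw [← spectrum.singleton_sub_eq, spectrum_adjMatrix_eq_range_adjEigenvalue]
      rintro _ ⟨_, rfl, _, ⟨i, rfl⟩, rfl⟩
      exact sub_nonneg.2 (G.adjEigenvalue_le_largestEigenvalue i)
  have := hpsd.dotProduct_mulVec_nonneg v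
  rw [sub_mulVec, Algebra.algebraMap_eq_smul_one, smul_mulVec, one_mulVec, dotProduct_sub,
    dotProduct_smul, star_trivial, smul_eq_mul] at this
  linarith

variable {G} in
-- The indicator vector of the clique has Rayleigh quotient `#s - 1`.
theorem IsClique.card_sub_one_le_largestEigenvalue [Nonempty V] {s : Finset V}
    (hs : G.IsClique s) (hne : s.Nonempty) : (#s : ℝ) - 1 ≤ G.largestEigenvalue := by
  set v : V → ℝ := fun x ↦ if x ∈ s then 1 else 0 with hv
  have hvv : v ⬝ᵥ v = #s := by simp [hv, dotProduct]
  have hAv : v ⬝ᵥ (G.adjMatrix ℝ *ᵥ v) = #s * (#s - 1) := by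
    have hx : ∀ x ∈ s, (G.adjMatrix ℝ *ᵥ v) x = #s - 1 := by
      intro x hx
      have : {y ∈ G.neighborFinset x | y ∈ s} = s.erase x := by
        ext y
        simp only [mem_filter, mem_neighborFinset, mem_erase]
        exact ⟨fun h ↦ ⟨h.1.ne', h.2⟩, fun h ↦ ⟨hs hx h.2 h.1.symm, h.2⟩⟩
      rw [adjMatrix_mulVec_apply, hv, sum_boole, this, card_erase_of_mem hx,
        Nat.cast_sub (card_pos.2 ⟨x, hx⟩), Nat.cast_one]
    simp only [dotProduct, hv, ite_mul, one_mul, zero_mul, sum_ite_mem, univ_inter]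
    rw [sum_congr rfl hx, sum_const, nsmul_eq_mul]
  have := G.dotProduct_adjMatrix_mulVec_le v
  rw [hAv, hvv, mul_comm] at this
  exact le_of_mul_le_mul_right this (by exact_mod_cast hne.card_pos)

section BalancedCompleteBipartite

variable {G} {c : V → Bool} {r : ℕ}

theorem leastEigenvalue_eq_of_adj_iff_ne [Nonempty V] (hadj : ∀ x y, G.Adj x y ↔ c x ≠ c y)
    (hcard : ∀ b, #{x | c x = b} = r) : G.leastEigenvalue = -r := by
  refine le_antisymm ?_ (neg_le_of_abs_le (abs_adjEigenvalue_le_of_degree_le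
    (fun x ↦ (degree_eq_of_adj_iff_ne hadj hcard x).le) _))
  -- The sign vector of the bipartition is an eigenvector for `-r`: each vertex has `r` neighbours,
  -- all of opposite sign.
  let v : V → ℝ := fun x ↦ if c x then 1 else -1
  have hv : v ≠ 0 := by
    refine Function.ne_iff.2 ⟨Classical.arbitrary V, ?_⟩
    by_cases h : c (Classical.arbitrary V) <;> simp [v, h]
  obtain ⟨i, hi⟩ := exists_adjEigenvalue_eq (G := G) (μ := -r) hv <| by
    ext x
    have : ∀ y ∈ G.neighborFinset x, v y = -v x := by
      intro y hy
      rw [mem_neighborFinset, hadj] at hy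
      revert hy
      simp only [v]
      cases c x <;> cases c y <;> simp
    rw [adjMatrix_mulVec_apply, sum_congr rfl this, sum_const, card_neighborFinset_eq_degree,
      degree_eq_of_adj_iff_ne hadj hcard]
    simp
  exact (G.leastEigenvalue_le_adjEigenvalue i).trans_eq hi

theorem largestEigenvalue_eq_of_isRegularOfDegree [Nonempty V] {d : ℕ}
    (h : G.IsRegularOfDegree d) : G.largestEigenvalue = d := by
  refine le_antisymm (le_of_abs_le (abs_adjEigenvalue_le_of_degree_le (fun x ↦ (h x).le) _)) ?_
  obtain ⟨i, hi⟩ := exists_adjEigenvalue_eq (G := G) (μ := d) (v := 1) one_ne_zero <| by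
    ext x
    simp [adjMatrix_mulVec_apply, h x]
  exact hi.ge.trans (G.adjEigenvalue_le_largestEigenvalue i)

theorem largestEigenvalue_compl_eq_of_adj_iff_ne [Nonempty V]
    (hadj : ∀ x y, G.Adj x y ↔ c x ≠ c y) (hcard : ∀ b, #{x | c x = b} = r) (hr : 0 < r) :
    Gᶜ.largestEigenvalue = r - 1 := by
  have hV : Fintype.card V = r + r := by
    rw [← card_univ, ← card_filter_add_card_filter_not (c · = true), hcard]
    simp [hcard]
  have hreg : Gᶜ.IsRegularOfDegree (r - 1) := by
    intro x
    rw [degree_compl, degree_eq_of_adj_iff_ne hadj hcard, hV]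
    omega
  rw [largestEigenvalue_eq_of_isRegularOfDegree hreg, Nat.cast_sub hr, Nat.cast_one]

end BalancedCompleteBipartite

variable {G} in
theorem exists_balanced_of_card_le_neg_leastEigenvalue [Nonempty V] (c : G.Coloring Bool)
    (h : ∀ x, (#{y | c y = c x} : ℝ) ≤ -G.leastEigenvalue) :
    ∃ r, 0 < r ∧ (∀ x y, G.Adj x y ↔ c x ≠ c y) ∧ ∀ b, #{x | c x = b} = r := by
  obtain ⟨v, hv, hAv⟩ := G.exists_eigenvector_adjEigenvalue
    ⟨Fintype.card V - 1, Nat.sub_lt Fintype.card_pos one_pos⟩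
  change G.adjMatrix ℝ *ᵥ v = G.leastEigenvalue • v at hAv
  have hcard (x) : (#{y | c y = c x} : ℝ) ≤ |G.leastEigenvalue| := (h x).trans (neg_le_abs _)
  have hsub (x) : G.neighborFinset x ⊆ ({y | c y = !c x} : Finset V) := by
    intro y hy
    rw [mem_neighborFinset] at hy
    rw [mem_filter_univ]
    exact Bool.eq_not.2 (c.valid hy).symm
  -- A vertex of maximal modulus is joined to the whole opposite class, and the modulus is maximal
  -- there too.
  have key {x} (hx : v x ≠ 0) (hmax : ∀ y, |v y| ≤ |v x|) :
      #{y | c y = c x} ≤ G.degree x ∧ ∀ y, c y = (!c x) → G.Adj x y ∧ |v y| = |v x| := by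
    have hdeg := abs_le_degree_of_abs_maximal hAv hx hmax
    have hle : #{y | c y = c x} ≤ G.degree x := by exact_mod_cast (hcard x).trans hdeg
    have hpos : 0 < G.degree x := (card_pos.2 ⟨x, by simp⟩).trans_le hle
    -- `h` bounds only classes that contain a vertex, so a neighbour is needed to bound the opposite
    -- class.
    obtain ⟨z, hz⟩ := (G.degree_pos_iff_exists_adj x).1 hpos
    have hcz : c z = !c x := Bool.eq_not.2 (c.valid hz).symm
    have hother : (#{y | c y = !c x} : ℝ) ≤ |G.leastEigenvalue| := hcz ▸ hcard z
    have hN : G.neighborFinset x = ({y | c y = !c x} : Finset V) :=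
      eq_of_subset_of_card_le (hsub x) (by
        rw [card_neighborFinset_eq_degree]
        exact_mod_cast hother.trans hdeg)
    refine ⟨hle, fun y hy ↦ ?_⟩
    have hxy : G.Adj x y := by
      rw [← mem_neighborFinset, hN, mem_filter_univ, hy]
    refine ⟨hxy, abs_eq_of_adj_of_degree_le_abs hAv hmax ?_ hxy⟩
    rwa [← card_neighborFinset_eq_degree, hN]
  obtain ⟨x, hx, hmax⟩ := exists_ne_zero_abs_maximal hv
  have hpos : 0 < #{y | c y = c x} := card_pos.2 ⟨x, by simp⟩
  obtain ⟨hle, hxN⟩ := key hx hmax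
  -- Vertices opposite to `x` inherit the maximal modulus, so `key` applies to them as well.
  have keyNot {y} (hy : c y = !c x) :
      #{z | c z = c y} ≤ G.degree y ∧ ∀ z, c z = (!c y) → G.Adj y z ∧ |v z| = |v y| := by
    have hyx := (hxN y hy).2
    exact key (abs_pos.1 (hyx ▸ abs_pos.2 hx)) (hyx ▸ hmax)
  have hdeg (x) : G.degree x ≤ #{y | c y = !c x} := by
    rw [← card_neighborFinset_eq_degree]
    exact card_le_card (hsub x)
  obtain ⟨y, hxy⟩ := (G.degree_pos_iff_exists_adj x).1 (hpos.trans_le hle)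
  have hy : c y = !c x := Bool.eq_not.2 (c.valid hxy).symm
  -- Each class is at most as large as a degree in it, hence at most as large as the other class.
  have heq : #{z | c z = !c x} = #{z | c z = c x} := by
    refine le_antisymm ?_ (hle.trans (hdeg x))
    have := (keyNot hy).1.trans (hdeg y)
    simpa only [hy, Bool.not_not] using this
  refine ⟨_, hpos, fun z w ↦ ⟨c.valid, fun hzw ↦ ?_⟩, fun b ↦ ?_⟩
  · rcases Bool.eq_or_eq_not (c z) (c x) with hz | hz
    · refine ((keyNot (y := w) ?_).2 z ?_).1.symm
      · rw [← hz]; exact Bool.eq_not.2 hzw.symm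
      · exact Bool.eq_not.2 hzw
    · exact ((keyNot hz).2 w (Bool.eq_not.2 hzw.symm)).1
  · rcases Bool.eq_or_eq_not b (c x) with rfl | rfl
    · rfl
    · exact heq

end SimpleGraph

theorem theorem3p5 {V : Type*} [Fintype V] [Nonempty V] [DecidableEq V]
    (G : SimpleGraph V) [DecidableRel G.Adj] (hG : G.IsBipartite) :
    Gᶜ.largestEigenvalue = -1 - G.leastEigenvalue ↔
      ∃ r : ℕ, 0 < r ∧ Nonempty (G ≃g completeBipartiteGraph (Fin r) (Fin r)) := by
  simp only [SimpleGraph.nonempty_iso_completeBipartiteGraph_iff]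
  constructor
  · intro h
    let c : G.Coloring Bool := hG.toColoring (by simp)
    obtain ⟨r, hr, hc⟩ := SimpleGraph.exists_balanced_of_card_le_neg_leastEigenvalue c fun x ↦ by
      have hclique : Gᶜ.IsClique ({y | c y = c x} : Finset V) := by
        intro y hy z hz hyz
        rw [mem_coe, mem_filter_univ] at hy hz
        exact ⟨hyz, fun hadj ↦ c.valid hadj (hy.trans hz.symm)⟩
      have := hclique.card_sub_one_le_largestEigenvalue ⟨x, by simp⟩
      linarith
    exact ⟨r, hr, c, hc⟩
  · rintro ⟨r, hr, c, hadj, hcard⟩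
    rw [SimpleGraph.largestEigenvalue_compl_eq_of_adj_iff_ne hadj hcard hr,
      SimpleGraph.leastEigenvalue_eq_of_adj_iff_ne hadj hcard]
    ring
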